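/- Let $S$ be a connected Dedekind scheme (a connected, locally Noetherian, normal scheme of dimension at most $1$; spectra of fields are allowed), let $f:X\to S$ be a faithfully flat morphism of finite type, and let $x\in X(S)$ be a section of $f$. A \emph{triple} $(Y,G,y)$ over $X$ consists of a flat $S$-group scheme $G$, an fpqc $G$-torsor $p:Y\to X$ (that is, $p$ is flat, surjective and quasi-compact, $G$ acts on $Y$ from the right over $X$, and $Y\times_S G\to Y\times_X Y$, $(y',g)\mapsto (y',y'g)$, is an isomorphism), and a point $y\in Y(S)$ with $p\circ y=x$. A morphism $(Y',G',y')\to(Y,G,y)$ of triples is a pair $(\alpha,\beta)$, where $\alpha:G'\to G$ is a homomorphism of $S$-group schemes and $\beta:Y'\to Y$ is an $X$-morphism, such that $\beta(y')=y$ and $\beta$ is compatible with the actions via $\alpha$. A triple $(Y,G,y)$ is \emph{preceded} by $(Y',G',y')$ if there is a morphism $(Y',G',y')\to(Y,G,y)$. A triple $(Y,G,y)$ is \emph{dominated} if for every triple $(Y',G',y')$ and every morphism $(Y',G',y')\to(Y,G,y)$ the homomorphism $G'\to G$ is schematically dominant, i.e. $\mathcal O_G\to\alpha_*\mathcal O_{G'}$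 is injective. Then every triple $(Y,G,y)$ over $X$ with $G$ finite and flat over $S$ is preceded by a dominated triple $(Y',G',y')$ with $G'$ finite and flat over $S$. -/

import Mathlib

open CategoryTheory Limits AlgebraicGeometry MonoidalCategory CartesianMonoidalCategory MonObj

universe u

/-- A Dedekind scheme: a locally Noetherian, normal scheme of dimension at most one. Normality and
the dimension bound are expressed on the local rings: they are Noetherian integrally closed domains
of Krull dimension at most one (fields and discrete valuation rings). Spectra of fields are
allowed. -/
class IsDedekindScheme (S : Scheme.{u}) : Prop where
  isLocallyNoetherian : IsLocallyNoetherian S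
  isDedekindDomain_stalk : ∀ s : S, IsDedekindDomain (S.presheaf.stalk s)

/-- A triple `(Y, G, y)` over the pointed `S`-scheme `(X, x)`: a flat `S`-group scheme `G`,
an fpqc `G`-torsor `p : Y ⟶ X` (`p` is flat, surjective and quasi-compact, `G` acts on `Y` from the
right over `X`, and `Y ×[S] G ⟶ Y ×[X] Y`, `(y, g) ↦ (y, y g)`, is an isomorphism), and an
`S`-point `y` of `Y` above `x`. -/
structure PointedTorsor {S : Scheme.{u}} (X : Over S) (x : 𝟙_ (Over S) ⟶ X) where
  /-- the structure group -/
  G : Over S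
  /-- the group structure on `G` -/
  grpObj : GrpObj G
  flat_group : Flat G.hom
  /-- the total space -/
  Y : Over S
  /-- the projection to the base -/
  p : Y ⟶ X
  /-- the right action of `G` on `Y` -/
  act : Y ⊗ G ⟶ Y
  act_one : Y ◁ η[G] ≫ act = (ρ_ Y).hom
  act_mul : (α_ Y G G).hom ≫ Y ◁ μ[G] ≫ act = act ▷ G ≫ act
  flat : Flat p.left
  surjective : Surjective p.left
  quasiCompact : QuasiCompact p.left
  /-- The action is over `X`, and `(y, g) ↦ (y, y g)` identifies `Y ×[S] G` with `Y ×[X] Y`. -/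
  isPullback : IsPullback (fst Y G) act p p
  /-- the marked point -/
  y : 𝟙_ (Over S) ⟶ Y
  y_p : y ≫ p = x

namespace PointedTorsor

attribute [instance] PointedTorsor.grpObj

variable {S : Scheme.{u}} {X : Over S} {x : 𝟙_ (Over S) ⟶ X}

/-- A morphism of triples: a homomorphism of `S`-group schemes and an equivariant `X`-morphism of
the total spaces which respects the marked points. -/
structure Hom (T T' : PointedTorsor X x) where
  /-- the homomorphism of group schemes -/
  onGroup : T.G ⟶ T'.G
  isMonHom : IsMonHom onGroup
  /-- the morphism of total spaces -/
  onTotal : T.Y ⟶ T'.Y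
  onTotal_p : onTotal ≫ T'.p = T.p
  equivariant : T.act ≫ onTotal = (onTotal ⊗ₘ onGroup) ≫ T'.act
  map_point : T.y ≫ onTotal = T'.y

/-- The triple lies in the category of finite triples: its structure group is finite (and flat)
over `S`. -/
def IsFiniteTriple (T : PointedTorsor X x) : Prop :=
  IsFinite T.G.hom

/-- A triple is dominated if every morphism of triples into it (from a triple whose flat structure
group need not be finite) is schematically dominant on the structure groups. -/
def IsDominated (T : PointedTorsor X x) : Prop :=
  ∀ (T' : PointedTorsor X x) (φ : Hom T' T), IsSchemeTheoreticallyDominant φ.onGroup.left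

/-- `T` is preceded by `T'` if there is a morphism of triples from `T'` to `T`. -/
def IsPrecededBy (T T' : PointedTorsor X x) : Prop :=
  Nonempty (Hom T' T)

end PointedTorsor

/-! Among the finite triples preceding the given one, pick one, `T₀`, whose group has minimal rank
at a point of `S`. A morphism from any triple into `T₀` factors through its scheme-theoretic image
(`PointedTorsor.exists_image`), a finite triple whose group is closed in that of `T₀`. By minimality
the two ranks agree at the point, hence everywhere since `S` is connected, so the closed immersion
is an isomorphism (`isIso_of_finrank_eq`) and the morphism was dominant.

The work is to show that images `H` of `G'` and `Z` of `Y'` form a triple. `H` is flat because flat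
means torsion-free over a Dedekind base (`Flat.of_comp_of_isSchemeTheoreticallyDominant`). Products
of dominant maps stay dominant under flatness, so the group law and the action restrict to the
images. As `X` need not be Dedekind, flatness of `Z` over `X` is proved after base change along
`Y'`, where `Z` becomes `Y' × H`, and then descended. -/

section Algebra

/-! ### Descent of flatness. -/

open TensorProduct

/-- If `C` is faithfully flat over `B` and flat over `A`, then `B` is flat over `A`. -/
lemma Module.Flat.of_flat_of_faithfullyFlat (A B C : Type*) [CommRing A] [CommRing B] [CommRing C]
    [Algebra A B] [Algebra B C] [Algebra A C] [IsScalarTower A B C] [Module.FaithfullyFlat B C]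
    [Module.Flat A C] : Module.Flat A B := by
  rw [Module.Flat.iff_lTensor_preserves_injective_linearMap]
  intro N P _ _ _ _ f hf
  have h : Function.Injective (LinearMap.lTensor C (f.baseChange B)) := by
    have e : ⇑(LinearMap.lTensor C (f.baseChange B)) =
        (AlgebraTensorModule.cancelBaseChange A B B C P).symm ∘ LinearMap.lTensor C f ∘
          (AlgebraTensorModule.cancelBaseChange A B B C N) := by
      have : (LinearMap.lTensor C (f.baseChange B)) =
          (AlgebraTensorModule.cancelBaseChange A B B C P).symm.toLinearMap ∘ₗ
            AlgebraTensorModule.lTensor B C f ∘ₗ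
              (AlgebraTensorModule.cancelBaseChange A B B C N).toLinearMap := by
        ext c n
        simp
      ext x
      exact congr($this x)
    rw [e]
    exact (AlgebraTensorModule.cancelBaseChange A B B C P).symm.injective.comp
      ((Module.Flat.lTensor_preserves_injective_linearMap f hf).comp
        (AlgebraTensorModule.cancelBaseChange A B B C N).injective)
  exact (Module.FaithfullyFlat.lTensor_injective_iff_injective B C (f.baseChange B)).mp h

lemma RingHom.Flat.of_comp_of_isLocalHom {A B C : Type*} [CommRing A] [CommRing B] [CommRing C]
    [IsLocalRing B] [IsLocalRing C] {f : A →+* B} {g : B →+* C} [IsLocalHom g]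
    (hg : g.Flat) (hgf : (g.comp f).Flat) : f.Flat := by
  algebraize [f, g, g.comp f]
  have : IsLocalHom (algebraMap B C) := ‹IsLocalHom g›
  have := Module.FaithfullyFlat.of_flat_of_isLocalHom (A := B) (B := C)
  exact Module.Flat.of_flat_of_faithfullyFlat A B C

end Algebra

namespace AlgebraicGeometry

lemma Flat.flat_stalkMap_of_comp {X Y Z : Scheme.{u}} (f : X ⟶ Y) (g : Y ⟶ Z) [Flat f]
    [Flat (f ≫ g)] (x : X) : (g.stalkMap (f x)).hom.Flat := by
  refine RingHom.Flat.of_comp_of_isLocalHom (g := (f.stalkMap x).hom) (Flat.stalkMap f x) ?_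
  rw [← CommRingCat.hom_comp, ← Scheme.Hom.stalkMap_comp]
  exact Flat.stalkMap (f ≫ g) x

/-- Every point of `Y` lifts to `X`, and flat local homomorphisms are faithfully flat, so flatness
of the stalk maps descends. -/
lemma Flat.of_comp_of_surjective {X Y Z : Scheme.{u}} (f : X ⟶ Y) (g : Y ⟶ Z) [Flat f]
    [Surjective f] [Flat (f ≫ g)] : Flat g := by
  refine Flat.of_stalkMap _ fun y ↦ ?_
  obtain ⟨x, rfl⟩ := f.surjective y
  exact Flat.flat_stalkMap_of_comp f g x

instance flat_fromSpecStalk (X : Scheme.{u}) (x : X) : Flat (X.fromSpecStalk x) := by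
  obtain ⟨_, ⟨U, hU, rfl⟩, hx, -⟩ :=
    X.isBasis_affineOpens.exists_subset_of_mem_open (Set.mem_univ x) isOpen_univ
  replace hU : IsAffineOpen U := hU
  rw [← hU.fromSpecStalk_eq_fromSpecStalk hx]
  change Flat (Spec.map _ ≫ _)
  have : Flat (Spec.map (X.presheaf.germ U x hx)) := by
    rw [Flat.SpecMap_iff]
    algebraize [(X.presheaf.germ U x hx).hom]
    have : IsLocalization.AtPrime (X.presheaf.stalk x) (hU.primeIdealOf ⟨x, hx⟩).asIdeal :=
      hU.isLocalization_stalk ⟨x, hx⟩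
    exact IsLocalization.flat _ (hU.primeIdealOf ⟨x, hx⟩).asIdeal.primeCompl
  infer_instance

/-- Flatness can be checked after base change to the spectra of the local rings of the target. -/
lemma Flat.of_pullback_fromSpecStalk {X S : Scheme.{u}} (f : X ⟶ S)
    (h : ∀ s, Flat (pullback.snd f (S.fromSpecStalk s))) : Flat f := by
  refine Flat.of_stalkMap _ fun x ↦ ?_
  obtain ⟨z, hz, -⟩ := Scheme.Pullback.exists_preimage_pullback (f := f)
    (g := S.fromSpecStalk (f x)) x (IsLocalRing.closedPoint (S.presheaf.stalk (f x)))
    (by rw [Scheme.fromSpecStalk_closedPoint])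
  have := h (f x)
  have : Flat (pullback.fst f (S.fromSpecStalk (f x)) ≫ f) := by
    rw [pullback.condition]
    infer_instance
  rw [← hz]
  exact Flat.flat_stalkMap_of_comp (pullback.fst f (S.fromSpecStalk (f x))) f z

end AlgebraicGeometry

/-! ### Scheme-theoretic images over a Dedekind base. -/

namespace AlgebraicGeometry

instance IsSchemeTheoreticallyDominant.toImage {X Y : Scheme.{u}} (f : X ⟶ Y) [QuasiCompact f] :
    IsSchemeTheoreticallyDominant f.toImage := by
  rw [isSchemeTheoreticallyDominant_iff]
  refine Scheme.IdealSheafData.ext_of_iSup_eq_top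
    (fun U : Y.affineOpens ↦ ⟨f.imageι ⁻¹ᵁ U, U.2.preimage f.imageι⟩) ?_ fun U ↦ ?_
  · rw [← Scheme.Hom.preimage_iSup, iSup_affineOpens_eq_top, Scheme.Hom.preimage_top]
  · simpa [Scheme.Hom.ker_apply, ← RingHom.injective_iff_ker_eq_bot] using f.toImage_app_injective U

/-- A morphism to the spectrum of a Dedekind domain is flat if some scheme-theoretically dominant
morphism to its source has flat composite. -/
lemma Flat.of_comp_of_isSchemeTheoreticallyDominant_Spec {R B : CommRingCat.{u}}
    [IsDedekindDomain R] {W : Scheme.{u}} (f : W ⟶ Spec B) [IsSchemeTheoreticallyDominant f]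
    [QuasiCompact f] (φ : R ⟶ B) [Flat (f ≫ Spec.map φ)] : Flat (Spec.map φ) := by
  rw [Flat.SpecMap_iff]
  algebraize [φ.hom]
  suffices Module.IsTorsionFree R B by exact (inferInstance : Module.Flat R B)
  refine .of_smul_eq_zero fun r b hrb ↦ ?_
  by_contra! h
  obtain ⟨hr, hb⟩ := h
  refine hb ((ConcreteCategory.bijective_of_isIso (Scheme.ΓSpecIso B).inv).1 ?_)
  rw [map_zero]
  refine f.app_injective ⊤ ?_
  rw [map_zero]
  -- Dominance makes `B` inject into the functions on `W`; on each affine piece these are flat,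
  -- hence torsion-free, over `R`, so the image of a torsion element vanishes.
  suffices key : ∀ (A : CommRingCat.{u}) (k : Spec A ⟶ W) [IsOpenImmersion k],
      k.appTop (f.appTop ((Scheme.ΓSpecIso B).inv b)) = 0 from
    Scheme.zero_of_zero_cover _ W.affineCover fun i ↦
      @key _ (W.affineCover.f i) (W.affineCover.map_prop i)
  intro A k _
  obtain ⟨ψ, hψ⟩ := Spec.map_surjective (k ≫ f)
  have hflat : (φ ≫ ψ).hom.Flat := by
    rw [← Flat.SpecMap_iff, Spec.map_comp, hψ, Category.assoc]
    infer_instance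
  have hψb : ψ b = 0 := by
    algebraize [(φ ≫ ψ).hom]
    have : r • ψ b = 0 := by
      rw [Algebra.smul_def]
      change (φ ≫ ψ) r * _ = 0
      rw [CommRingCat.comp_apply, ← map_mul]
      have : φ r * b = r • b := (Algebra.smul_def r b).symm
      rw [this, hrb, map_zero]
    exact (smul_eq_zero.mp this).resolve_left hr
  have h := congr(Scheme.Hom.appTop $hψ ((Scheme.ΓSpecIso B).inv b))
  rw [Scheme.Hom.comp_appTop, CommRingCat.comp_apply] at h
  refine h.symm.trans ?_
  rw [← CommRingCat.comp_apply, ← Scheme.ΓSpecIso_inv_naturality, CommRingCat.comp_apply, hψb,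
    map_zero]

/-- A scheme affine over a Dedekind scheme is flat if it receives a quasi-compact,
scheme-theoretically dominant morphism from a flat scheme. -/
lemma Flat.of_comp_of_isSchemeTheoreticallyDominant {S W H : Scheme.{u}} [IsDedekindScheme S]
    (f : W ⟶ H) [IsSchemeTheoreticallyDominant f] [QuasiCompact f] (g : H ⟶ S) [IsAffineHom g]
    [Flat (f ≫ g)] : Flat g := by
  -- Localization is a flat base change, so it preserves dominance of the quasi-compact `f`;
  -- affineness of `g` then reduces to the case of spectra.
  refine Flat.of_pullback_fromSpecStalk g fun s ↦ ?_
  have : IsDedekindDomain (S.presheaf.stalk s) := IsDedekindScheme.isDedekindDomain_stalk s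
  let i := S.fromSpecStalk s
  have : Flat (pullback.snd f (pullback.fst g i) ≫ pullback.snd g i) :=
    MorphismProperty.of_isPullback (P := @Flat)
      ((IsPullback.of_hasPullback f (pullback.fst g i)).paste_vert
        (IsPullback.of_hasPullback g i)) ‹Flat (f ≫ g)›
  let e := (pullback g i).isoSpec
  obtain ⟨φ, hφ⟩ := Spec.map_surjective (e.inv ≫ pullback.snd g i)
  have : Flat ((pullback.snd f (pullback.fst g i) ≫ e.hom) ≫ Spec.map φ) := by
    rw [hφ]
    simpa
  have := Flat.of_comp_of_isSchemeTheoreticallyDominant_Spec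
    (pullback.snd f (pullback.fst g i) ≫ e.hom) φ
  have h : pullback.snd g i = e.hom ≫ Spec.map φ := by simp [hφ]
  change Flat (pullback.snd g i)
  rw [h]
  infer_instance

/-! ### Ranks of finite flat schemes and closed immersions. -/

section Rank

lemma _root_.Module.rankAtStalk_le_of_surjective {R M N : Type*} [CommRing R] [AddCommGroup M]
    [Module R M] [AddCommGroup N] [Module R N] [Module.Finite R M] (φ : M →ₗ[R] N)
    (hφ : Function.Surjective φ) (p : PrimeSpectrum R) :
    Module.rankAtStalk N p ≤ Module.rankAtStalk M p :=
  LinearMap.finrank_le_finrank_of_surjective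
    (f := LocalizedModule.map p.asIdeal.primeCompl φ) (LocalizedModule.map_surjective _ φ hφ)

/-- Locally on the base, a closed immersion into a finite scheme is given by a surjective ring
homomorphism. -/
lemma exists_isPullback_Spec_of_isClosedImmersion {H G S : Scheme.{u}} (i : H ⟶ G)
    [IsClosedImmersion i] (g : G ⟶ S) [IsFinite g] {R : CommRingCat.{u}} (j : Spec R ⟶ S) :
    ∃ (B C : CommRingCat.{u}) (φ : R ⟶ B) (ψ : B ⟶ C) (b : Spec B ⟶ G) (c : Spec C ⟶ H),
      Function.Surjective ψ ∧ IsPullback b (Spec.map φ) g j ∧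
      IsPullback c (Spec.map ψ) i b := by
  let G' := pullback g j
  have : IsAffine G' := isAffine_of_isAffineHom (pullback.snd g j)
  let b : Spec Γ(G', ⊤) ⟶ G := G'.isoSpec.inv ≫ pullback.fst g j
  let H' := pullback i b
  have : IsAffine H' := isAffine_of_isAffineHom (pullback.snd i b)
  obtain ⟨φ, hφ⟩ := Spec.map_surjective (G'.isoSpec.inv ≫ pullback.snd g j)
  obtain ⟨ψ, hψ⟩ := Spec.map_surjective (H'.isoSpec.inv ≫ pullback.snd i b)
  refine ⟨_, _, φ, ψ, b, H'.isoSpec.inv ≫ pullback.fst i b, ?_, ?_, ?_⟩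
  · have : IsClosedImmersion (Spec.map ψ) := by
      rw [hψ]
      infer_instance
    have h := (IsClosedImmersion.isAffine_surjective_of_isAffine (Spec.map ψ)).2
    have e : ψ = (Scheme.ΓSpecIso _).inv ≫ (Spec.map ψ).appTop ≫ (Scheme.ΓSpecIso _).hom := by
      simp
    rw [e]
    exact ((ConcreteCategory.bijective_of_isIso (Scheme.ΓSpecIso _).hom).2.comp h).comp
      (ConcreteCategory.bijective_of_isIso (Scheme.ΓSpecIso _).inv).2
  · exact .of_iso (.of_hasPullback g j) G'.isoSpec (.refl _) (.refl _) (.refl _)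
      (by simp [b]) (by simp [hφ]) (by simp) (by simp)
  · exact .of_iso (.of_hasPullback i b) H'.isoSpec (.refl _) (.refl _) (.refl _)
      (by simp) (by simp [hψ]) (by simp) (by simp)

variable {H G S : Scheme.{u}} (i : H ⟶ G) [IsClosedImmersion i] (g : G ⟶ S)
    [IsFinite g] [Flat g] [Flat (i ≫ g)]

/-- The affine form of a closed immersion into a finite flat scheme with flat source: the ranks are
those of a surjective linear map of finite flat modules. -/
lemma exists_linearMap_of_isClosedImmersion {R : CommRingCat.{u}} (j : Spec R ⟶ S) :
    ∃ (B C : CommRingCat.{u}) (_ : Algebra R B) (_ : Algebra R C) (ψ : B ⟶ C) (b : Spec B ⟶ G)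
      (c : Spec C ⟶ H) (q : Spec B ⟶ Spec R) (l : B →ₗ[R] C),
      Module.Finite R B ∧ Module.Flat R B ∧ Module.Finite R C ∧ Module.Flat R C ∧
      Function.Surjective l ∧ (∀ x, l x = ψ x) ∧ IsPullback b q g j ∧
      IsPullback c (Spec.map ψ) i b ∧ (∀ s, g.finrank (j s) = Module.rankAtStalk B s) ∧
      ∀ s, (i ≫ g).finrank (j s) = Module.rankAtStalk C s := by
  obtain ⟨B, C, φ, ψ, b, c, hψ, hb, hc⟩ := exists_isPullback_Spec_of_isClosedImmersion i g j
  have hcb := hc.paste_vert hb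
  have h₁ : IsFinite (Spec.map φ) := MorphismProperty.of_isPullback hb ‹_›
  have h₂ : Flat (Spec.map φ) := MorphismProperty.of_isPullback hb ‹_›
  have h₃ : IsFinite (Spec.map (φ ≫ ψ)) := by
    rw [Spec.map_comp]
    exact MorphismProperty.of_isPullback (P := @IsFinite) hcb inferInstance
  have h₄ : Flat (Spec.map (φ ≫ ψ)) := by
    rw [Spec.map_comp]
    exact MorphismProperty.of_isPullback hcb ‹_›
  rw [IsFinite.SpecMap_iff] at h₁ h₃
  rw [Flat.SpecMap_iff] at h₂ h₄
  let := φ.hom.toAlgebra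
  let := (φ ≫ ψ).hom.toAlgebra
  refine ⟨B, C, φ.hom.toAlgebra, (φ ≫ ψ).hom.toAlgebra, ψ, b, c, Spec.map φ,
    AlgHom.toLinearMap ⟨ψ.hom, fun _ ↦ rfl⟩, h₁, h₂, h₃, h₄, hψ, fun _ ↦ rfl, hb, hc,
    fun s ↦ ?_, fun s ↦ ?_⟩
  · rw [← Scheme.Hom.finrank_of_isPullback _ _ _ _ hb,
      Scheme.Hom.finrank_SpecMap_eq_finrank h₁ h₂]
    rfl
  · rw [← Scheme.Hom.finrank_of_isPullback _ _ _ _ hcb, ← Spec.map_comp,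
      Scheme.Hom.finrank_SpecMap_eq_finrank h₃ h₄]
    rfl

lemma Scheme.Hom.finrank_le_of_isClosedImmersion (s : S) :
    (i ≫ g).finrank s ≤ g.finrank s := by
  obtain ⟨R, j, _, s, rfl⟩ := S.exists_Spec_apply_eq s
  obtain ⟨B, C, _, _, ψ, b, c, q, l, _, _, _, _, hl, -, -, -, hB, hC⟩ :=
    exists_linearMap_of_isClosedImmersion i g j
  rw [hB, hC]
  exact Module.rankAtStalk_le_of_surjective l hl s

/-- Locally on `S` this is the fact that a surjection of finite flat modules of equal rank is
bijective. -/
lemma isIso_of_finrank_eq (h : (i ≫ g).finrank = g.finrank) : IsIso i := by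
  rw [← MorphismProperty.isomorphisms.iff, IsZariskiLocalAtTarget.iff_of_openCover
    (P := .isomorphisms Scheme) (S.affineCover.pullback₁ g)]
  suffices key : ∀ (R : CommRingCat.{u}) (j : Spec R ⟶ S),
      IsIso (pullback.snd i (pullback.fst g j)) from fun k ↦ key _ (S.affineCover.f k)
  intro R j
  obtain ⟨B, C, _, _, ψ, b, c, q, l, _, _, _, _, hl, hlψ, hb, hc, hB, hC⟩ :=
    exists_linearMap_of_isClosedImmersion i g j
  suffices IsIso ψ by
    have hc' : IsPullback c (Spec.map ψ ≫ hb.isoPullback.hom) i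
        (pullback.fst g j) :=
      hc.of_iso (.refl _) (.refl _) hb.isoPullback (.refl _) (by simp) (by simp) (by simp)
        (by simp)
    rw [← hc'.isoPullback_inv_snd]
    infer_instance
  rw [ConcreteCategory.isIso_iff_bijective]
  have := Module.bijective_of_surjective_of_rankAtStalk_eq hl fun m _ ↦
    (hB ⟨m, inferInstance⟩).symm.trans ((congrFun h.symm _).trans (hC _))
  rwa [funext hlψ] at this

end Rank

end AlgebraicGeometry

/-! ### Dominant morphisms, closed immersions and fibre products. -/

namespace AlgebraicGeometry

lemma IsSchemeTheoreticallyDominant.of_comp {X Y Z : Scheme.{u}} (f : X ⟶ Y) (g : Y ⟶ Z)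
    [IsSchemeTheoreticallyDominant (f ≫ g)] : IsSchemeTheoreticallyDominant g := by
  rw [isSchemeTheoreticallyDominant_iff, ← le_bot_iff, ← (f ≫ g).ker_eq_bot]
  exact Scheme.Hom.le_ker_comp f g

lemma isIso_of_isClosedImmersion_of_isSchemeTheoreticallyDominant {X Y : Scheme.{u}} (f : X ⟶ Y)
    [IsClosedImmersion f] [IsSchemeTheoreticallyDominant f] : IsIso f :=
  IsClosedImmersion.isIso_iff_ker_eq_bot.mpr f.ker_eq_bot

/-- Cancelling the monomorphism `c` shows that `n` is a closed immersion, and `m` shows that its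
ideal is zero. In the application `n` compares a product with a fibre product over `X`, and `c`
embeds the latter in the ambient torsor. -/
lemma isIso_of_isClosedImmersion_comp {W X Y Z : Scheme.{u}} (m : W ⟶ X) (n : X ⟶ Y) (c : Y ⟶ Z)
    [Mono c] [IsClosedImmersion (n ≫ c)] [IsSchemeTheoreticallyDominant (m ≫ n)] : IsIso n := by
  have : IsClosedImmersion n :=
    MorphismProperty.of_postcomp (W := @IsClosedImmersion) (W' := @IsSeparated) n c
      inferInstance ‹_›
  have := IsSchemeTheoreticallyDominant.of_comp m n
  exact isIso_of_isClosedImmersion_of_isSchemeTheoreticallyDominant n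

/-- Fibre products over `X` of scheme-theoretically dominant morphisms, under flatness. -/
lemma IsSchemeTheoreticallyDominant.of_isPullback_of_isPullback {X Y₁ Y₂ Z₁ Z₂ P Q : Scheme.{u}}
    (d₁ : Y₁ ⟶ Z₁) (d₂ : Y₂ ⟶ Z₂) [IsSchemeTheoreticallyDominant d₁] [QuasiCompact d₁]
    [IsSchemeTheoreticallyDominant d₂] [QuasiCompact d₂] {q₁ : Z₁ ⟶ X} {q₂ : Z₂ ⟶ X}
    [Flat q₂] [Flat (d₁ ≫ q₁)] {a₁ : P ⟶ Y₁} {a₂ : P ⟶ Y₂} {b₁ : Q ⟶ Z₁} {b₂ : Q ⟶ Z₂}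
    (hP : IsPullback a₁ a₂ (d₁ ≫ q₁) (d₂ ≫ q₂)) (hQ : IsPullback b₁ b₂ q₁ q₂) (m : P ⟶ Q)
    (h₁ : m ≫ b₁ = a₁ ≫ d₁) (h₂ : m ≫ b₂ = a₂ ≫ d₂) : IsSchemeTheoreticallyDominant m := by
  -- Factor `m` through `Y₁ ×[X] Z₂`: the two factors are base changes of `d₂` and `d₁` along flat
  -- morphisms.
  have hR := IsPullback.of_hasPullback (d₁ ≫ q₁) q₂
  let r : pullback (d₁ ≫ q₁) q₂ ⟶ Q := hQ.lift (pullback.fst _ _ ≫ d₁) (pullback.snd _ _)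
    (by simp [pullback.condition])
  let k : P ⟶ pullback (d₁ ≫ q₁) q₂ := pullback.lift a₁ (a₂ ≫ d₂) (by simp [hP.w])
  have hk₁ : k ≫ pullback.fst _ _ = a₁ := pullback.lift_fst _ _ _
  have hk₂ : k ≫ pullback.snd _ _ = a₂ ≫ d₂ := pullback.lift_snd _ _ _
  have hr₁ : r ≫ b₁ = pullback.fst _ _ ≫ d₁ := hQ.lift_fst _ _ _
  have hr₂ : r ≫ b₂ = pullback.snd _ _ := hQ.lift_snd _ _ _
  have hm : k ≫ r = m := hQ.hom_ext (by rw [Category.assoc, hr₁, reassoc_of% hk₁, h₁])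
    (by rw [Category.assoc, hr₂, hk₂, h₂])
  have hr : IsPullback (pullback.fst (d₁ ≫ q₁) q₂) r d₁ b₁ :=
    .of_bot (by rwa [hr₂]) hr₁.symm hQ
  have hk : IsPullback a₂ k d₂ (pullback.snd (d₁ ≫ q₁) q₂) :=
    .of_bot (by rw [hk₁]; exact hP.flip) hk₂.symm hR.flip
  have : Flat b₁ := MorphismProperty.of_isPullback (P := @Flat) hQ.flip ‹_›
  have := IsSchemeTheoreticallyDominant.of_isPullback hr
  have := IsSchemeTheoreticallyDominant.of_isPullback hk
  rw [← hm]
  infer_instance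

end AlgebraicGeometry

/-! ### Images of homomorphisms of group schemes. -/

section

variable {S : Scheme.{u}}

/-- Since `f` is dominant, `v` and `f ≫ v` have the same kernel ideal, and the latter contains that
of `i`. This is how the group law and the torsor action pass to images. -/
lemma exists_lift_of_isSchemeTheoreticallyDominant {D A H G : Over S} (f : D ⟶ A) (i : H ⟶ G)
    (u : D ⟶ H) (v : A ⟶ G) [IsSchemeTheoreticallyDominant f.left] [IsClosedImmersion i.left]
    (w : f ≫ v = u ≫ i) : ∃ l : A ⟶ H, l ≫ i = v ∧ f ≫ l = u := by
  have hker : i.left.ker ≤ v.left.ker := by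
    have h₁ : (f.left ≫ v.left).ker = v.left.ker := by
      rw [Scheme.Hom.ker_comp, f.left.ker_eq_bot, Scheme.IdealSheafData.map_bot]
    rw [← h₁, ← Over.comp_left, w, Over.comp_left]
    exact Scheme.Hom.le_ker_comp _ _
  have hl := IsClosedImmersion.lift_fac i.left v.left hker
  let l : A ⟶ H := Over.homMk (IsClosedImmersion.lift i.left v.left hker) (by
    rw [← Over.w i, reassoc_of% hl, Over.w])
  have : Mono i := Over.mono_of_mono_left i
  have hl' : l ≫ i = v := by ext; exact hl
  exact ⟨l, hl', by rw [← cancel_mono i, Category.assoc, hl', w]⟩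

lemma exists_schemeTheoretic_image {W G : Over S} (f : W ⟶ G) [QuasiCompact f.left] :
    ∃ (H : Over S) (d : W ⟶ H) (i : H ⟶ G), d ≫ i = f ∧ IsSchemeTheoreticallyDominant d.left ∧
      QuasiCompact d.left ∧ IsClosedImmersion i.left :=
  ⟨.mk (f.left.imageι ≫ G.hom), Over.homMk f.left.toImage (by simp), Over.homMk f.left.imageι rfl,
    by ext; simp, .toImage f.left, (inferInstance : QuasiCompact f.left.toImage),
    (inferInstance : IsClosedImmersion f.left.imageι)⟩

lemma isSchemeTheoreticallyDominant_tensorHom {D A D' A' : Over S} (f : D ⟶ A) (g : D' ⟶ A')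
    [IsSchemeTheoreticallyDominant f.left] [QuasiCompact f.left]
    [IsSchemeTheoreticallyDominant g.left] [QuasiCompact g.left] [Flat D.hom] [Flat A'.hom] :
    IsSchemeTheoreticallyDominant (f ⊗ₘ g).left := by
  have : Flat (f.left ≫ A.hom) := by rwa [Over.w]
  have hP : IsPullback (fst D D').left (snd D D').left (f.left ≫ A.hom) (g.left ≫ A'.hom) := by
    simpa using IsPullback.of_hasPullback D.hom D'.hom
  have hQ : IsPullback (fst A A').left (snd A A').left A.hom A'.hom :=
    IsPullback.of_hasPullback A.hom A'.hom
  refine IsSchemeTheoreticallyDominant.of_isPullback_of_isPullback f.left g.left hP hQ _ ?_ ?_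
  · rw [← Over.comp_left, tensorHom_fst, Over.comp_left]
  · rw [← Over.comp_left, tensorHom_snd, Over.comp_left]

/-- The scheme-theoretic image of a homomorphism of flat group schemes is a subgroup scheme, if it
is flat. -/
lemma exists_grpObj_of_isSchemeTheoreticallyDominant {K H G : Over S} [GrpObj K] [GrpObj G]
    (d : K ⟶ H) (i : H ⟶ G) [IsMonHom (d ≫ i)] [IsSchemeTheoreticallyDominant d.left]
    [QuasiCompact d.left] [IsClosedImmersion i.left] [Flat K.hom] [Flat H.hom] :
    ∃ _ : GrpObj H, IsMonHom d ∧ IsMonHom i := by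
  have : Mono i := Over.mono_of_mono_left i
  have := isSchemeTheoreticallyDominant_tensorHom d d
  obtain ⟨m, hm, hdm⟩ := exists_lift_of_isSchemeTheoreticallyDominant (d ⊗ₘ d) i (μ ≫ d)
    ((i ⊗ₘ i) ≫ μ) (by
      rw [Category.assoc, IsMonHom.mul_hom (d ≫ i), tensorHom_comp_tensorHom_assoc])
  obtain ⟨v, hv, hdv⟩ := exists_lift_of_isSchemeTheoreticallyDominant d i (ι ≫ d)
    (i ≫ ι) (by
      rw [Category.assoc, GrpObj.inv_hom (d ≫ i), Category.assoc])
  have hη : (η[K] ≫ d) ≫ i = η := by rw [Category.assoc, IsMonHom.one_hom]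
  -- Each axiom follows from that of `G` after cancelling the monomorphism `i`.
  let inst : GrpObj H :=
    { one := η[K] ≫ d
      mul := m
      inv := v
      one_mul := by
        rw [← cancel_mono i, Category.assoc, hm, whiskerRight_comp_tensorHom_assoc, hη,
          tensorHom_def', Category.assoc, MonObj.one_mul, leftUnitor_naturality]
      mul_one := by
        rw [← cancel_mono i, Category.assoc, hm, whiskerLeft_comp_tensorHom_assoc, hη,
          MonoidalCategory.tensorHom_def, Category.assoc, MonObj.mul_one, rightUnitor_naturality]
      mul_assoc := by
        simp only [← cancel_mono i, Category.assoc, hm, whiskerRight_comp_tensorHom_assoc,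
          whiskerLeft_comp_tensorHom_assoc]
        rw [← tensorHom_comp_whiskerRight_assoc, ← tensorHom_comp_whiskerLeft_assoc,
          MonObj.mul_assoc, associator_naturality_assoc]
      left_inv := by
        rw [← cancel_mono i, Category.assoc, hm, lift_map_assoc, hv, Category.id_comp,
          Category.assoc, hη, ← comp_toUnit_assoc i, ← GrpObj.left_inv, comp_lift_assoc,
          Category.comp_id]
      right_inv := by
        rw [← cancel_mono i, Category.assoc, hm, lift_map_assoc, hv, Category.id_comp,
          Category.assoc, hη, ← comp_toUnit_assoc i, ← GrpObj.right_inv, comp_lift_assoc,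
          Category.comp_id] }
  exact ⟨inst, ⟨rfl, hdm.symm⟩, ⟨hη, hm⟩⟩

lemma isPullback_fst_whiskerRight {A A' : Over S} (f : A ⟶ A') (B : Over S) :
    IsPullback (fst A B).left (f ▷ B).left f.left (fst A' B).left := by
  have h : IsPullback (fst A B).left (snd A B).left A.hom B.hom := IsPullback.of_hasPullback _ _
  have h' : IsPullback (fst A' B).left (snd A' B).left A'.hom B.hom := IsPullback.of_hasPullback _ _
  refine .of_bot (v₂₂ := A'.hom) ?_ ?_ h'
  · rwa [← Over.comp_left, whiskerRight_snd, Over.w]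
  · rw [← Over.comp_left, ← Over.comp_left, whiskerRight_fst]

lemma isPullback_snd_whiskerLeft {A A' : Over S} (f : A ⟶ A') (B : Over S) :
    IsPullback (snd B A).left (B ◁ f).left f.left (snd B A').left := by
  have h : IsPullback (fst B A).left (snd B A).left B.hom A.hom := IsPullback.of_hasPullback _ _
  have h' : IsPullback (fst B A').left (snd B A').left B.hom A'.hom := IsPullback.of_hasPullback _ _
  refine .of_bot (v₂₂ := A'.hom) ?_ ?_ h'.flip
  · rw [← Over.comp_left, whiskerLeft_fst, Over.w]
    exact h.flip
  · rw [← Over.comp_left, ← Over.comp_left, whiskerLeft_snd]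

instance isClosedImmersion_whiskerRight_left {A A' : Over S} (f : A ⟶ A') [IsClosedImmersion f.left]
    (B : Over S) : IsClosedImmersion (f ▷ B).left :=
  MorphismProperty.of_isPullback (isPullback_fst_whiskerRight f B) ‹_›

instance isClosedImmersion_whiskerLeft_left {A A' : Over S} (f : A ⟶ A') [IsClosedImmersion f.left]
    (B : Over S) : IsClosedImmersion (B ◁ f).left :=
  MorphismProperty.of_isPullback (isPullback_snd_whiskerLeft f B) ‹_›

instance isClosedImmersion_tensorHom_left {A A' B B' : Over S} (f : A ⟶ A') (g : B ⟶ B')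
    [IsClosedImmersion f.left] [IsClosedImmersion g.left] : IsClosedImmersion (f ⊗ₘ g).left := by
  rw [MonoidalCategory.tensorHom_def, Over.comp_left]
  infer_instance

end

/-! ### The image of a morphism of triples. -/

namespace PointedTorsor

variable {S : Scheme.{u}} {X : Over S} {x : 𝟙_ (Over S) ⟶ X}

lemma isPullback_left (T : PointedTorsor X x) :
    IsPullback (fst T.Y T.G).left T.act.left T.p.left T.p.left :=
  T.isPullback.map (Over.forget S)

lemma act_p (T : PointedTorsor X x) : T.act ≫ T.p = fst T.Y T.G ≫ T.p :=
  T.isPullback.w.symm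

/-- The structure group is quasi-compact, as a base change of the total space. -/
lemma quasiCompact_group (T : PointedTorsor X x) : QuasiCompact T.G.hom := by
  have := T.quasiCompact
  have h₁ : QuasiCompact (fst T.Y T.G).left :=
    MorphismProperty.of_isPullback (P := @QuasiCompact) T.isPullback_left.flip ‹_›
  -- Pulling `Y × G ⟶ Y` back along the marked point recovers `G ⟶ S`.
  have h₂ : IsPullback (lift (toUnit T.G ≫ T.y) (𝟙 T.G)).left T.G.hom (fst T.Y T.G).left
      T.y.left := by
    have : IsPullback (fst T.Y T.G).left (snd T.Y T.G).left T.Y.hom T.G.hom :=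
      IsPullback.of_hasPullback _ _
    have hy : T.y.left ≫ T.Y.hom = 𝟙 S := Over.w T.y
    refine .of_right (h₁₂ := (snd T.Y T.G).left) (h₂₂ := T.Y.hom) (v₁₃ := T.G.hom) ?_ ?_ this.flip
    · rw [← Over.comp_left, lift_snd, hy, Over.id_left]
      exact IsPullback.of_horiz_isIso ⟨by simp⟩
    · rw [← Over.comp_left, lift_fst]
      rfl
  exact MorphismProperty.of_isPullback (P := @QuasiCompact) h₂ h₁

/-- A torsor under a separated group scheme is separated over its base. -/
lemma isSeparated_p (T : PointedTorsor X x) [IsSeparated T.G.hom] : IsSeparated T.p.left := by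
  -- The unit section of `Y × G` is closed because `G` is separated, and it becomes the diagonal of
  -- `Y ×[X] Y`.
  let u : T.Y ⟶ T.Y ⊗ T.G := lift (𝟙 _) (toUnit _ ≫ η)
  have hu : u ≫ T.act = 𝟙 _ := by
    rw [show u = (ρ_ T.Y).inv ≫ T.Y ◁ η by ext <;> simp [u], Category.assoc, T.act_one,
      Iso.inv_hom_id]
  have hu' : u.left ≫ (fst T.Y T.G).left = 𝟙 _ := by
    rw [← Over.comp_left, lift_fst, Over.id_left]
  have : IsSeparated (fst T.Y T.G).left :=
    inferInstanceAs (IsSeparated (pullback.fst T.Y.hom T.G.hom))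
  have : IsClosedImmersion u.left :=
    MorphismProperty.of_postcomp (W := @IsClosedImmersion) (W' := @IsSeparated) _
      (fst T.Y T.G).left ‹_› (by rw [hu']; infer_instance)
  have hdiag : pullback.diagonal T.p.left = u.left ≫ T.isPullback_left.isoPullback.hom := by
    apply pullback.hom_ext
    · rw [Category.assoc, IsPullback.isoPullback_hom_fst, hu', pullback.diagonal_fst]
    · rw [Category.assoc, IsPullback.isoPullback_hom_snd, ← Over.comp_left, hu,
        pullback.diagonal_snd, Over.id_left]
  exact ⟨by rw [hdiag]; infer_instance⟩

/-- A morphism into a finite triple factors through its scheme-theoretic image, again a finite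
triple. -/
lemma exists_image [IsDedekindScheme S] [Flat X.hom] {T T' : PointedTorsor X x}
    (hT : T.IsFiniteTriple) (φ : Hom T' T) :
    ∃ (T'' : PointedTorsor X x) (_ : T''.IsFiniteTriple) (a : Hom T' T'') (b : Hom T'' T),
      a.onGroup ≫ b.onGroup = φ.onGroup ∧ IsSchemeTheoreticallyDominant a.onGroup.left ∧
      IsClosedImmersion b.onGroup.left := by
  have : IsFinite T.G.hom := hT
  have := T'.quasiCompact_group
  have := T.isSeparated_p
  have := φ.isMonHom
  have := T'.flat_group
  have := T'.flat
  have := T'.surjective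
  have := T'.quasiCompact
  have := T.quasiCompact
  have : QuasiCompact φ.onGroup.left := by
    have : QuasiCompact (φ.onGroup.left ≫ T.G.hom) := by rwa [Over.w]
    exact .of_comp _ T.G.hom
  have : QuasiCompact φ.onTotal.left := by
    have : QuasiCompact (φ.onTotal.left ≫ T.p.left) := by
      rwa [← Over.comp_left, φ.onTotal_p]
    exact .of_comp _ T.p.left
  obtain ⟨H, d, i, hdi, _, _, _⟩ := exists_schemeTheoretic_image φ.onGroup
  obtain ⟨Z, e, j, hej, _, _, _⟩ := exists_schemeTheoretic_image φ.onTotal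
  have : Mono i := Over.mono_of_mono_left i
  have : Mono j := Over.mono_of_mono_left j
  have : IsFinite H.hom := by
    rw [← Over.w i]
    infer_instance
  have : Flat H.hom := by
    have : Flat (d.left ≫ H.hom) := by rwa [Over.w]
    exact Flat.of_comp_of_isSchemeTheoreticallyDominant d.left H.hom
  have : Flat T'.Y.hom := by
    rw [← Over.w T'.p]
    infer_instance
  have : IsMonHom (d ≫ i) := by rwa [hdi]
  obtain ⟨_, _, _⟩ := exists_grpObj_of_isSchemeTheoreticallyDominant d i
  have hed := isSchemeTheoreticallyDominant_tensorHom e d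
  obtain ⟨act, hact, hact'⟩ := exists_lift_of_isSchemeTheoreticallyDominant (e ⊗ₘ d) j (T'.act ≫ e)
    ((j ⊗ₘ i) ≫ T.act) (by
      rw [tensorHom_comp_tensorHom_assoc, hej, hdi, Category.assoc, hej, φ.equivariant])
  have hp : e ≫ j ≫ T.p = T'.p := by rw [reassoc_of% hej, φ.onTotal_p]
  have hactp : act ≫ j ≫ T.p = fst Z H ≫ j ≫ T.p := by
    rw [reassoc_of% hact, T.act_p, tensorHom_fst_assoc]
  -- The trivialization of `Y` over `Y'` puts both `Y' × H` and `Y' ×[X] Z` inside `Y' × G`. The map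
  -- `n` between them will be an isomorphism, so `Y' ×[X] Z` is flat over `Y'`, hence over `X`, and
  -- flatness descends along `q₂`.
  have hflat : Flat (j ≫ T.p).left := by
    let q₁ := pullback.fst T'.p.left (j ≫ T.p).left
    let q₂ := pullback.snd T'.p.left (j ≫ T.p).left
    have hQ : IsPullback q₁ q₂ T'.p.left (j ≫ T.p).left := .of_hasPullback _ _
    have hG : IsPullback (fst T'.Y T.G).left (φ.onTotal ▷ T.G ≫ T.act).left T'.p.left T.p.left := by
      have := (isPullback_fst_whiskerRight φ.onTotal T.G).paste_vert T.isPullback_left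
      rwa [← Over.comp_left, ← Over.comp_left, φ.onTotal_p] at this
    let n : (T'.Y ⊗ H).left ⟶ pullback T'.p.left (j ≫ T.p).left :=
      hQ.lift (fst T'.Y H).left (e ▷ H ≫ act).left (by
        rw [← Over.comp_left, ← Over.comp_left, Category.assoc, hactp, whiskerRight_fst_assoc, hp])
    have hn₁ : n ≫ q₁ = (fst T'.Y H).left := hQ.lift_fst _ _ _
    have hn₂ : n ≫ q₂ = (e ▷ H ≫ act).left := hQ.lift_snd _ _ _
    let c : pullback T'.p.left (j ≫ T.p).left ⟶ (T'.Y ⊗ T.G).left :=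
      hG.lift q₁ (q₂ ≫ j.left) (hQ.w.trans (Category.assoc _ _ _).symm)
    have hc₁ : c ≫ (fst T'.Y T.G).left = q₁ := hG.lift_fst _ _ _
    have hc₂ : c ≫ (φ.onTotal ▷ T.G ≫ T.act).left = q₂ ≫ j.left := hG.lift_snd _ _ _
    have : Mono c := ⟨fun a b hab ↦ hQ.hom_ext (by rw [← hc₁, reassoc_of% hab]) (by
      rw [← cancel_mono j.left, Category.assoc, Category.assoc, ← hc₂, reassoc_of% hab])⟩
    have hnc : n ≫ c = (T'.Y ◁ i).left := by
      refine hG.hom_ext ?_ ?_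
      · rw [Category.assoc, hc₁, hn₁, ← Over.comp_left, whiskerLeft_fst]
      · rw [Category.assoc, hc₂, reassoc_of% hn₂, ← Over.comp_left, ← Over.comp_left,
          Category.assoc, hact, whiskerRight_comp_tensorHom_assoc, hej,
          ← MonoidalCategory.tensorHom_def'_assoc]
    have : IsClosedImmersion (n ≫ c) := by
      rw [hnc]
      infer_instance
    let m := (T'.Y ◁ d).left ≫ n
    -- With `Y' × G'` read as `Y' ×[X] Y'`, `m` is the base change of the dominant `e` along the
    -- flat `q₂`.
    have hm : IsPullback T'.act.left m e.left q₂ := by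
      refine .of_bot (v₂₂ := (j ≫ T.p).left) ?_ ?_ hQ.flip
      · rw [Category.assoc, hn₁, ← Over.comp_left, ← Over.comp_left, whiskerLeft_fst, hp]
        exact T'.isPullback_left.flip
      · rw [Category.assoc, hn₂, ← Over.comp_left, ← Over.comp_left,
          ← MonoidalCategory.tensorHom_def'_assoc, hact']
    have : Flat q₂ := MorphismProperty.of_isPullback (P := @Flat) hQ ‹_›
    have : Surjective q₂ := MorphismProperty.of_isPullback (P := @Surjective) hQ ‹_›
    have : IsSchemeTheoreticallyDominant m := .of_isPullback hm
    have : IsIso n := isIso_of_isClosedImmersion_comp (T'.Y ◁ d).left n c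
    have : Flat (fst T'.Y H).left := inferInstanceAs (Flat (pullback.fst T'.Y.hom H.hom))
    have : Flat q₁ := by
      rw [← IsIso.inv_comp_eq n |>.mpr hn₁.symm]
      infer_instance
    have : Flat (q₂ ≫ (j ≫ T.p).left) := by
      rw [← hQ.w]
      infer_instance
    exact Flat.of_comp_of_surjective q₂ _
  -- Now that `Z` is flat over `X`, the map from `Y' ×[X] Y'` to `Z ×[X] Z` is dominant; it factors
  -- through `Z × H`, which is closed in `Y × G`.
  have hpb : IsPullback (fst Z H) act (j ≫ T.p) (j ≫ T.p) := by
    refine .of_map (Over.forget S) hactp.symm ?_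
    let q₁ := pullback.fst (j ≫ T.p).left (j ≫ T.p).left
    let q₂ := pullback.snd (j ≫ T.p).left (j ≫ T.p).left
    have hQ : IsPullback q₁ q₂ (j ≫ T.p).left (j ≫ T.p).left := .of_hasPullback _ _
    let n : (Z ⊗ H).left ⟶ pullback (j ≫ T.p).left (j ≫ T.p).left :=
      hQ.lift (fst Z H).left act.left (by rw [← Over.comp_left, ← Over.comp_left, hactp])
    have hn₁ : n ≫ q₁ = (fst Z H).left := hQ.lift_fst _ _ _
    have hn₂ : n ≫ q₂ = act.left := hQ.lift_snd _ _ _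
    let c : pullback (j ≫ T.p).left (j ≫ T.p).left ⟶ (T.Y ⊗ T.G).left :=
      T.isPullback_left.lift (q₁ ≫ j.left) (q₂ ≫ j.left) (by simpa using hQ.w)
    have hc₁ : c ≫ (fst T.Y T.G).left = q₁ ≫ j.left := T.isPullback_left.lift_fst _ _ _
    have hc₂ : c ≫ T.act.left = q₂ ≫ j.left := T.isPullback_left.lift_snd _ _ _
    have : Mono c := ⟨fun a b hab ↦ hQ.hom_ext
      (by rw [← cancel_mono j.left, Category.assoc, Category.assoc, ← hc₁, reassoc_of% hab])
      (by rw [← cancel_mono j.left, Category.assoc, Category.assoc, ← hc₂, reassoc_of% hab])⟩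
    have hnc : n ≫ c = (j ⊗ₘ i).left := by
      refine T.isPullback_left.hom_ext ?_ ?_
      · rw [Category.assoc, hc₁, reassoc_of% hn₁, ← Over.comp_left, ← Over.comp_left,
          tensorHom_fst]
      · rw [Category.assoc, hc₂, reassoc_of% hn₂, ← Over.comp_left, ← Over.comp_left, hact]
    have : IsClosedImmersion (n ≫ c) := by
      rw [hnc]
      infer_instance
    have hep : e.left ≫ (j ≫ T.p).left = T'.p.left := by rw [← Over.comp_left, hp]
    have : Flat (e.left ≫ (j ≫ T.p).left) := by rwa [hep]
    have hT' : IsPullback (fst T'.Y T'.G).left T'.act.left (e.left ≫ (j ≫ T.p).left)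
        (e.left ≫ (j ≫ T.p).left) := by
      rw [hep]
      exact T'.isPullback_left
    have : IsSchemeTheoreticallyDominant ((e ⊗ₘ d).left ≫ n) :=
      .of_isPullback_of_isPullback e.left e.left hT' hQ _
        (by rw [Category.assoc, hn₁, ← Over.comp_left, ← Over.comp_left, tensorHom_fst])
        (by rw [Category.assoc, hn₂, ← Over.comp_left, ← Over.comp_left, hact'])
    have : IsIso n := isIso_of_isClosedImmersion_comp (e ⊗ₘ d).left n c
    exact hQ.of_iso (asIso n).symm (.refl _) (.refl _) (.refl _) (by simp [← hn₁])
      (by simp [← hn₂]) (by simp) (by simp)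
  let T'' : PointedTorsor X x :=
    { G := H
      grpObj := inferInstance
      flat_group := inferInstance
      Y := Z
      p := j ≫ T.p
      act := act
      act_one := by
        rw [← cancel_mono j, Category.assoc, hact, whiskerLeft_comp_tensorHom_assoc,
          IsMonHom.one_hom, MonoidalCategory.tensorHom_def, Category.assoc, T.act_one,
          rightUnitor_naturality]
      act_mul := by
        rw [← cancel_mono j]
        simp only [Category.assoc, hact, whiskerRight_comp_tensorHom_assoc,
          whiskerLeft_comp_tensorHom_assoc, IsMonHom.mul_hom]
        rw [← tensorHom_comp_whiskerRight_assoc, ← tensorHom_comp_whiskerLeft_assoc,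
          ← T.act_mul, associator_naturality_assoc]
      flat := hflat
      surjective := by
        have : Surjective (e.left ≫ (j ≫ T.p).left) := by
          rwa [← Over.comp_left, hp]
        exact .of_comp e.left _
      quasiCompact := by
        rw [Over.comp_left]
        infer_instance
      isPullback := hpb
      y := T'.y ≫ e
      y_p := by rw [Category.assoc, hp, T'.y_p] }
  exact ⟨T'', ‹IsFinite H.hom›, ⟨d, ‹_›, e, hp, hact'.symm, rfl⟩,
    ⟨i, ‹_›, j, rfl, hact, by simp [T'', hej, φ.map_point]⟩, hdi, ‹_›, ‹_›⟩

end PointedTorsor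

/-! ### Precedence and the minimal rank argument. -/

namespace PointedTorsor

variable {S : Scheme.{u}} {X : Over S} {x : 𝟙_ (Over S) ⟶ X}

lemma isPrecededBy_refl (T : PointedTorsor X x) : T.IsPrecededBy T :=
  ⟨⟨𝟙 _, inferInstance, 𝟙 _, by simp, by simp, by simp⟩⟩

lemma IsPrecededBy.trans {T T' T'' : PointedTorsor X x} (h : T.IsPrecededBy T')
    (h' : T'.IsPrecededBy T'') : T.IsPrecededBy T'' := by
  obtain ⟨φ⟩ := h
  obtain ⟨ψ⟩ := h'
  have := φ.isMonHom
  have := ψ.isMonHom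
  exact ⟨⟨ψ.onGroup ≫ φ.onGroup, inferInstance, ψ.onTotal ≫ φ.onTotal,
    by rw [Category.assoc, φ.onTotal_p, ψ.onTotal_p],
    by rw [reassoc_of% ψ.equivariant, φ.equivariant, tensorHom_comp_tensorHom_assoc],
    by rw [reassoc_of% ψ.map_point, φ.map_point]⟩⟩

end PointedTorsor

theorem mainTheorem5 (S : Scheme.{u}) [IsDedekindScheme S] [ConnectedSpace S]
    (X : Over S) [Flat X.hom] [Surjective X.hom] [LocallyOfFiniteType X.hom] [QuasiCompact X.hom]
    (x : 𝟙_ (Over S) ⟶ X) (T : PointedTorsor X x) (hT : T.IsFiniteTriple) :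
    ∃ T' : PointedTorsor X x, T'.IsFiniteTriple ∧ T'.IsDominated ∧ T.IsPrecededBy T' := by
  have : IsLocallyNoetherian S := IsDedekindScheme.isLocallyNoetherian
  obtain ⟨s⟩ : Nonempty S := inferInstance
  obtain ⟨T₀, ⟨h₀, hT₀⟩, hmin⟩ := exists_minimalFor_of_wellFoundedLT
    (fun T' : PointedTorsor X x ↦ T'.IsFiniteTriple ∧ T.IsPrecededBy T')
    (fun T' ↦ T'.G.hom.finrank s) ⟨T, hT, T.isPrecededBy_refl⟩
  refine ⟨T₀, h₀, fun T' φ ↦ ?_, hT₀⟩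
  obtain ⟨T'', h, a, b, hab, _, _⟩ := PointedTorsor.exists_image h₀ φ
  have : IsFinite T₀.G.hom := h₀
  have : IsFinite T''.G.hom := h
  have := T₀.flat_group
  have := T''.flat_group
  have hw := Over.w b.onGroup
  have : Flat (b.onGroup.left ≫ T₀.G.hom) := by rwa [hw]
  have hle := Scheme.Hom.finrank_le_of_isClosedImmersion b.onGroup.left T₀.G.hom s
  rw [hw] at hle
  -- The image triple also precedes `T`, so it competes in the minimization.
  have heq := hle.antisymm (hmin ⟨h, hT₀.trans ⟨b⟩⟩ hle)
  -- Finite presentation, available over the locally Noetherian `S`, makes the ranks locally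
  -- constant, so that equality at `s` spreads over the connected base.
  have : LocallyOfFinitePresentation T₀.G.hom :=
    LocallyOfFinitePresentation.iff_locallyOfFiniteType.mpr inferInstance
  have : LocallyOfFinitePresentation T''.G.hom :=
    LocallyOfFinitePresentation.iff_locallyOfFiniteType.mpr inferInstance
  have : IsIso b.onGroup.left := by
    refine isIso_of_finrank_eq b.onGroup.left T₀.G.hom (funext fun t ↦ ?_)
    rw [hw, T''.G.hom.isLocallyConstant_finrank.apply_eq_of_preconnectedSpace t s, heq]
    exact T₀.G.hom.isLocallyConstant_finrank.apply_eq_of_preconnectedSpace s t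
  rw [← hab, Over.comp_left]
  infer_instance
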